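/- Let $d\ge 1$, let $\psi:[0,\infty)\to[0,\infty)$ be an increasing (i.e. non-decreasing) function with $\lim_{r\to\infty}\psi(r)=\infty$, and let $\|\cdot\|$ be the Euclidean norm on $\mathbb R^d$. Let $$C_\psi(\mathbb R^d)=\Big\{\phi:\mathbb R^d\to\mathbb C \;:\; \phi \text{ is continuous and } \lim_{\|x\|\to\infty}\frac{\phi(x)}{e^{\psi(\|x\|)}}=0\Big\},\qquad \|\phi\|_\psi=\sup_{x\in\mathbb R^d}\frac{|\phi(x)|}{e^{\psi(\|x\|)}}.$$ For $L>0$ let $Q(0,L)=\{\lambda\in\mathbb R^d : |\lambda_j|<L/\sqrt d,\ 1\le j\le d\}$, let $e_\lambda(x)=e^{i\lambda\cdot x}$, and let $\Phi_L(\mathbb R^d)$ be the complex linear span of $\{e_\lambda:\lambda\in Q(0,L)\}$. If $$\int_1^\infty\frac{\psi(r)}{r^2}\,dr=\infty,$$ then for every $L>0$ the space $\Phi_L(\mathbb R^d)$ is contained in $C_\psi(\mathbb R^d)$ and is dense in the normed space $(C_\psi(\mathbb R^d),\|\cdot\|_\psi)$. -/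

import Mathlib

open scoped NNReal ENNReal
open Filter Topology MeasureTheory

noncomputable section

/-- The continuous functions `φ : ℝ^d → ℂ` with `φ(x) / e^{ψ(‖x‖)} → 0` as `‖x‖ → ∞`, as a complex
subspace of the space of all functions. -/
def weightedSubmodule (d : ℕ) (ψ : ℝ≥0 → ℝ≥0) :
    Submodule ℂ (EuclideanSpace ℝ (Fin d) → ℂ) where
  carrier := {φ | Continuous φ ∧
    Tendsto (fun x => φ x / (Real.exp (ψ ‖x‖₊) : ℂ))
      (Bornology.cobounded (EuclideanSpace ℝ (Fin d))) (𝓝 0)}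
  add_mem' := by
    rintro f g ⟨hf, hf'⟩ ⟨hg, hg'⟩
    refine ⟨hf.add hg, ?_⟩
    simpa [add_div] using hf'.add hg'
  zero_mem' := ⟨continuous_const, by simpa using tendsto_const_nhds⟩
  smul_mem' := by
    rintro c f ⟨hf, hf'⟩
    refine ⟨hf.const_smul c, ?_⟩
    simpa [mul_div_assoc] using hf'.const_mul c

/-- The space `C_ψ(ℝ^d)`. It is a type of its own, so that its only topology is the one that comes
from the weighted norm below (a subtype of a function space would also carry the topology of
pointwise convergence). -/
def WeightedSpace (d : ℕ) (ψ : ℝ≥0 → ℝ≥0) : Type := ↥(weightedSubmodule d ψ)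

namespace WeightedSpace

variable {d : ℕ} {ψ : ℝ≥0 → ℝ≥0}

instance : AddCommGroup (WeightedSpace d ψ) :=
  inferInstanceAs (AddCommGroup ↥(weightedSubmodule d ψ))

instance : Module ℂ (WeightedSpace d ψ) :=
  inferInstanceAs (Module ℂ ↥(weightedSubmodule d ψ))

/-- The inclusion of `C_ψ(ℝ^d)` in the space of all functions `ℝ^d → ℂ`. -/
def toFunₗ (d : ℕ) (ψ : ℝ≥0 → ℝ≥0) :
    WeightedSpace d ψ →ₗ[ℂ] (EuclideanSpace ℝ (Fin d) → ℂ) :=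
  (weightedSubmodule d ψ).subtype

/-- The norm `‖φ‖_ψ = sup_x |φ(x)| / e^{ψ(‖x‖)}`. -/
instance : Norm (WeightedSpace d ψ) where
  norm φ := ⨆ x : EuclideanSpace ℝ (Fin d), ‖toFunₗ d ψ φ x‖ / Real.exp (ψ ‖x‖₊)

theorem norm_def (φ : WeightedSpace d ψ) :
    ‖φ‖ = ⨆ x : EuclideanSpace ℝ (Fin d), ‖toFunₗ d ψ φ x‖ / Real.exp (ψ ‖x‖₊) := rfl

/-- The supremum that defines the norm is finite. -/
theorem bddAbove (φ : WeightedSpace d ψ) :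
    BddAbove (Set.range fun x : EuclideanSpace ℝ (Fin d) =>
      ‖toFunₗ d ψ φ x‖ / Real.exp (ψ ‖x‖₊)) := by
  have hc : Continuous (toFunₗ d ψ φ) := φ.2.1
  have ht : Tendsto (fun x => toFunₗ d ψ φ x / (Real.exp (ψ ‖x‖₊) : ℂ))
      (Bornology.cobounded (EuclideanSpace ℝ (Fin d))) (𝓝 0) := φ.2.2
  have h1 : ∀ᶠ x in Bornology.cobounded (EuclideanSpace ℝ (Fin d)),
      ‖toFunₗ d ψ φ x‖ / Real.exp (ψ ‖x‖₊) < 1 := by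
    have := (tendsto_zero_iff_norm_tendsto_zero.1 ht).eventually (gt_mem_nhds one_pos)
    filter_upwards [this] with x hx
    rwa [norm_div, Complex.norm_real, Real.norm_of_nonneg (Real.exp_pos _).le] at hx
  rw [Metric.cobounded_eq_cocompact, Filter.hasBasis_cocompact.eventually_iff] at h1
  obtain ⟨K, hK, hK'⟩ := h1
  obtain ⟨C, hC⟩ := hK.exists_bound_of_continuousOn hc.continuousOn
  refine ⟨max C 1, ?_⟩
  rintro _ ⟨x, rfl⟩
  by_cases hx : x ∈ K
  · refine le_trans ?_ ((hC x hx).trans (le_max_left _ _))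
    exact div_le_self (norm_nonneg _) (Real.one_le_exp (ψ ‖x‖₊).2)
  · exact (hK' hx).le.trans (le_max_right _ _)

theorem le_norm (φ : WeightedSpace d ψ) (x : EuclideanSpace ℝ (Fin d)) :
    ‖toFunₗ d ψ φ x‖ / Real.exp (ψ ‖x‖₊) ≤ ‖φ‖ :=
  le_ciSup (bddAbove φ) x

theorem core : NormedSpace.Core ℂ (WeightedSpace d ψ) where
  norm_nonneg φ := Real.iSup_nonneg fun x => by positivity
  norm_smul c φ := by
    simp only [norm_def, map_smul, Pi.smul_apply, norm_smul, mul_div_assoc]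
    exact (Real.mul_iSup_of_nonneg (norm_nonneg c) _).symm
  norm_triangle f g := by
    refine ciSup_le fun x => ?_
    refine le_trans ?_ (add_le_add (le_norm f x) (le_norm g x))
    rw [← add_div, map_add, Pi.add_apply]
    gcongr
    exact norm_add_le _ _
  norm_eq_zero_iff φ := by
    constructor
    · intro h
      have h0 : toFunₗ d ψ φ = 0 := by
        funext x
        have hx := le_norm φ x
        rw [h, div_le_iff₀ (Real.exp_pos _), zero_mul] at hx
        exact norm_le_zero_iff.1 hx
      exact Subtype.ext h0
    · rintro rfl
      simp [norm_def]

/-- `(C_ψ(ℝ^d), ‖·‖_ψ)` is a normed linear space. -/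
instance : NormedAddCommGroup (WeightedSpace d ψ) := NormedAddCommGroup.ofCore core

instance : NormedSpace ℂ (WeightedSpace d ψ) := NormedSpace.ofCore core

end WeightedSpace

/-- The open cube `Q(0,L)` in `ℝ^d`, centred at the origin, of side length `2L/√d`. -/
def openCube (d : ℕ) (L : ℝ) : Set (EuclideanSpace ℝ (Fin d)) :=
  {x | ∀ j, |x j| < L / √(d : ℝ)}

/-- The exponential `e_λ(x) = e^{i λ·x}`. -/
def expFun {d : ℕ} (l : EuclideanSpace ℝ (Fin d)) : EuclideanSpace ℝ (Fin d) → ℂ :=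
  fun x => Complex.exp (Complex.I * (inner ℝ l x : ℝ))

/-- `Φ_L(ℝ^d)`, the complex linear span of the `e_λ` with `λ ∈ Q(0,L)`. -/
def expSpan (d : ℕ) (L : ℝ) : Submodule ℂ (EuclideanSpace ℝ (Fin d) → ℂ) :=
  Submodule.span ℂ (expFun '' openCube d L)

end

noncomputable section

/-! Let `p` be the distance to `Φ_L` in the weighted norm. Exponentials with arbitrary frequencies
span a dense subspace (`dense_span_range_exponential`), so it suffices that `p(e_l) = 0` for all
`l`. This holds for short `l` and is propagated along rays.

The propagation is quasi-analyticity in finite-difference form, without duality. Expand `1 = (w + (1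
- w))^(2n)` with `w = e_{-hv}(x)`. The terms with at least `n` factors `w`, multiplied by
`e_{(t+nh)v}`, are differences of exponentials with frequencies in `[t - nh, t]v`. The others
contain `1 - w` to a power above `n`: they are small for `‖x‖ ≤ R` and are beaten by the weight for
`‖x‖ > R` (`seminorm_exponential_extrapolate`).

With `h = 1/(16R)`, `n = 8m` and `ψ(R) ≥ 5n`, a bound `64^(-8m)` decays to `64^(-m)` while the
interval of frequencies grows by `n/(16R)` (`seminorm_exponential_step`). Descending through `m =
8^k` gains a length comparable to `∑ 8^k / R_k`, which diverges because the integral does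
(`exists_radii_not_summable`). Every point of the ray is thus reached at an arbitrarily small final
bound. -/

theorem norm_expFun {d : ℕ} (l x : EuclideanSpace ℝ (Fin d)) : ‖expFun l x‖ = 1 := by
  rw [expFun, mul_comm, Complex.norm_exp_ofReal_mul_I]

theorem continuous_expFun {d : ℕ} (l : EuclideanSpace ℝ (Fin d)) : Continuous (expFun l) := by
  unfold expFun
  fun_prop

/-- The weight tends to infinity at infinity. -/
theorem tendsto_weight {d : ℕ} {ψ : ℝ≥0 → ℝ≥0} (hψ : Tendsto ψ atTop atTop) :
    Tendsto (fun x : EuclideanSpace ℝ (Fin d) => Real.exp (ψ ‖x‖₊))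
      (Bornology.cobounded (EuclideanSpace ℝ (Fin d))) atTop := by
  refine Real.tendsto_exp_atTop.comp (NNReal.tendsto_coe_atTop.2 (hψ.comp ?_))
  rw [← NNReal.tendsto_coe_atTop]
  exact tendsto_norm_cobounded_atTop

theorem mem_weightedSubmodule_of_bounded {d : ℕ} {ψ : ℝ≥0 → ℝ≥0} (hψ : Tendsto ψ atTop atTop)
    {f : EuclideanSpace ℝ (Fin d) → ℂ} (hf : Continuous f) {C : ℝ} (hC : ∀ x, ‖f x‖ ≤ C) :
    f ∈ weightedSubmodule d ψ := by
  refine ⟨hf, squeeze_zero_norm (a := fun x => C / Real.exp (ψ ‖x‖₊)) (fun x => ?_) ?_⟩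
  · rw [norm_div, Complex.norm_real, Real.norm_of_nonneg (Real.exp_pos _).le]
    gcongr
    exact hC x
  · exact (tendsto_weight hψ).const_div_atTop C

/-! ### Backward differences of exponentials and the binomial splitting -/

namespace WeightedSpace

variable {d : ℕ} {ψ : ℝ≥0 → ℝ≥0}

theorem norm_le_of_forall (φ : WeightedSpace d ψ) {C : ℝ}
    (h : ∀ x, ‖toFunₗ d ψ φ x‖ ≤ C * Real.exp (ψ ‖x‖₊)) : ‖φ‖ ≤ C :=
  ciSup_le fun x => (div_le_iff₀ (Real.exp_pos _)).2 (h x)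

/-- The exponential `e_l` as an element of `C_ψ(ℝ^d)`. -/
def exponential (hψ : Tendsto ψ atTop atTop) (l : EuclideanSpace ℝ (Fin d)) :
    WeightedSpace d ψ :=
  ⟨expFun l, mem_weightedSubmodule_of_bounded hψ (continuous_expFun l)
    fun x => (norm_expFun l x).le⟩

theorem toFunₗ_exponential (hψ : Tendsto ψ atTop atTop) (l : EuclideanSpace ℝ (Fin d)) :
    toFunₗ d ψ (exponential hψ l) = expFun l := rfl

/-- The `m`-th backward difference, of step `h` in the direction `v`, of `t ↦ e_{tv}`. -/
def backwardDiff (hψ : Tendsto ψ atTop atTop) (v : EuclideanSpace ℝ (Fin d)) (h : ℝ) :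
    ℕ → ℝ → WeightedSpace d ψ
  | 0, t => exponential hψ (t • v)
  | m + 1, t => backwardDiff hψ v h m t - backwardDiff hψ v h m (t - h)

theorem expFun_smul (v x : EuclideanSpace ℝ (Fin d)) (t : ℝ) :
    expFun (t • v) x = Complex.exp (Complex.I * (t * (inner ℝ v x : ℝ) : ℝ)) := by
  rw [expFun, real_inner_smul_left]

theorem expFun_add_smul (v x : EuclideanSpace ℝ (Fin d)) (s t : ℝ) :
    expFun ((s + t) • v) x = expFun (s • v) x * expFun (t • v) x := by
  simp only [expFun_smul, ← Complex.exp_add]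
  congr 1
  push_cast
  ring

theorem expFun_natCast_mul_smul (v x : EuclideanSpace ℝ (Fin d)) (n : ℕ) (t : ℝ) :
    expFun ((n * t) • v) x = expFun (t • v) x ^ n := by
  simp only [expFun_smul, ← Complex.exp_nat_mul]
  congr 1
  push_cast
  ring

theorem toFunₗ_backwardDiff (hψ : Tendsto ψ atTop atTop) (v : EuclideanSpace ℝ (Fin d)) (h : ℝ)
    (m : ℕ) (t : ℝ) (x : EuclideanSpace ℝ (Fin d)) :
    toFunₗ d ψ (backwardDiff hψ v h m t) x =
      expFun (t • v) x * (1 - expFun ((-h) • v) x) ^ m := by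
  induction m generalizing t with
  | zero => simp [backwardDiff, toFunₗ_exponential]
  | succ m ih =>
    rw [backwardDiff, map_sub, Pi.sub_apply, ih, ih, sub_eq_add_neg t h, expFun_add_smul]
    ring

theorem seminorm_backwardDiff_le (p : Seminorm ℂ (WeightedSpace d ψ))
    (hψ : Tendsto ψ atTop atTop) (v : EuclideanSpace ℝ (Fin d)) {h B : ℝ} (hh : 0 ≤ h)
    (m : ℕ) (t : ℝ)
    (hB : ∀ s, t - m * h ≤ s → s ≤ t → p (exponential hψ (s • v)) ≤ B) :
    p (backwardDiff hψ v h m t) ≤ 2 ^ m * B := by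
  induction m generalizing t with
  | zero => simpa [backwardDiff] using hB t (by simp) le_rfl
  | succ m ih =>
    have h1 := ih t fun s hs => hB s (by push_cast; linarith)
    have h2 := ih (t - h) fun s hs hs' => hB s (by push_cast; linarith) (by linarith)
    calc _ ≤ p (backwardDiff hψ v h m t) + p (backwardDiff hψ v h m (t - h)) :=
          map_sub_le_add p _ _
      _ ≤ 2 ^ (m + 1) * B := by rw [pow_succ]; linarith

/-- Splitting of the binomial expansion of `(w + (1 - w)) ^ (2 * n)` at the middle. -/
theorem one_sub_pow_mul_sum_choose (n : ℕ) (w : ℂ) :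
    1 - w ^ n * ∑ j ∈ Finset.range (n + 1), ((2 * n).choose (n + j) : ℂ) *
        (w ^ j * (1 - w) ^ (n - j)) =
      ∑ k ∈ Finset.range n, ((2 * n).choose k : ℂ) * (w ^ k * (1 - w) ^ (2 * n - k)) := by
  have h1 : (1 : ℂ) = ∑ k ∈ Finset.range (n + (n + 1)),
      ((2 * n).choose k : ℂ) * (w ^ k * (1 - w) ^ (2 * n - k)) := by
    have h := add_pow w (1 - w) (2 * n)
    rw [add_sub_cancel, one_pow] at h
    rw [show n + (n + 1) = 2 * n + 1 by ring]
    exact h.trans (Finset.sum_congr rfl fun k _ => mul_comm _ _)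
  rw [sub_eq_iff_eq_add]
  conv_lhs => rw [h1]
  rw [Finset.sum_range_add, Finset.mul_sum]
  congr 1
  refine Finset.sum_congr rfl fun j hj => ?_
  rw [show 2 * n - (n + j) = n - j by omega, pow_add]
  ring

theorem sum_choose_two_mul_le (n : ℕ) (s : Finset ℕ) (hs : s ⊆ Finset.range (2 * n + 1)) :
    ∑ k ∈ s, ((2 * n).choose k : ℝ) ≤ 4 ^ n := by
  calc _ ≤ ∑ k ∈ Finset.range (2 * n + 1), ((2 * n).choose k : ℝ) :=
        Finset.sum_le_sum_of_subset_of_nonneg hs fun _ _ _ => by positivity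
    _ = 4 ^ n := by
        rw [← Nat.cast_sum, Nat.sum_range_choose, pow_mul]
        norm_num

theorem norm_sum_choose_le (n : ℕ) {w : ℂ} (hw : ‖w‖ = 1) {c : ℝ} (hc0 : 0 ≤ c)
    (hc : ∀ k < n, ‖1 - w‖ ^ (2 * n - k) ≤ c) :
    ‖∑ k ∈ Finset.range n, ((2 * n).choose k : ℂ) * (w ^ k * (1 - w) ^ (2 * n - k))‖ ≤
      4 ^ n * c := by
  calc _ ≤ ∑ k ∈ Finset.range n, ((2 * n).choose k : ℝ) * c := by
        refine norm_sum_le_of_le _ fun k hk => ?_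
        rw [norm_mul, norm_mul, norm_pow, norm_pow, hw, one_pow, one_mul, Complex.norm_natCast]
        gcongr
        exact hc k (Finset.mem_range.1 hk)
    _ ≤ 4 ^ n * c := by
        rw [← Finset.sum_mul]
        gcongr
        exact sum_choose_two_mul_le n _ (Finset.range_subset_range.2 (by omega))

end WeightedSpace

/-! ### Extrapolation of bounds along a ray -/

namespace WeightedSpace

variable {d : ℕ} {ψ : ℝ≥0 → ℝ≥0}

/-- Extrapolation of a smallness estimate for exponentials in a seminorm bounded by the weighted
norm. -/
theorem seminorm_exponential_extrapolate (p : Seminorm ℂ (WeightedSpace d ψ))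
    (hp : ∀ φ, p φ ≤ ‖φ‖) (hψ : Tendsto ψ atTop atTop) (hψ_mono : Monotone ψ)
    {v : EuclideanSpace ℝ (Fin d)} (hv : ‖v‖ ≤ 1) (n : ℕ) {h B : ℝ} (hh : 0 ≤ h) (R : ℝ≥0)
    (hR : h * R ≤ 1) (t : ℝ)
    (hB : ∀ s, t - n * h ≤ s → s ≤ t → p (exponential hψ (s • v)) ≤ B) :
    p (exponential hψ ((t + n * h) • v)) ≤
      (4 * (h * R)) ^ n + 16 ^ n * Real.exp (-ψ R) + 8 ^ n * B := by
  have hB0 : 0 ≤ B := (apply_nonneg p _).trans (hB t (by simp; positivity) le_rfl)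
  set S : WeightedSpace d ψ := ∑ j ∈ Finset.range (n + 1), ((2 * n).choose (n + j) : ℂ) •
    backwardDiff hψ v h (n - j) (t - j * h) with hS
  have hpS : p S ≤ 8 ^ n * B := by
    have h1 : p S ≤ ∑ j ∈ Finset.range (n + 1), ((2 * n).choose (n + j) : ℝ) * (2 ^ n * B) := by
      refine (Finset.le_sum_of_subadditive p (map_zero p).le (map_add_le_add p) _ _).trans (Finset.sum_le_sum fun j hj => ?_)
      have hj' : j ≤ n := Nat.lt_succ_iff.1 (Finset.mem_range.1 hj)
      have hjn : (j : ℝ) ≤ n := by exact_mod_cast hj'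
      rw [map_smul_eq_mul, Complex.norm_natCast]
      gcongr
      -- For every `j` the lowest sample is `t - j h - (n - j) h = t - n h`.
      refine (seminorm_backwardDiff_le p hψ v hh (n - j) (t - j * h)
        (fun s hs hs' => hB s ?_ ?_)).trans ?_
      · rw [Nat.cast_sub hj'] at hs
        linarith
      · have : 0 ≤ j * h := by positivity
        linarith
      · gcongr
        · norm_num
        · omega
    refine h1.trans ?_
    rw [← Finset.sum_mul]
    have h2 : ∑ j ∈ Finset.range (n + 1), ((2 * n).choose (n + j) : ℝ) ≤ 4 ^ n := by
      have := sum_choose_two_mul_le n (Finset.Ico n (2 * n + 1)) fun k hk => by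
        simp only [Finset.mem_Ico, Finset.mem_range] at *
        omega
      rw [Finset.sum_Ico_eq_sum_range] at this
      rwa [show 2 * n + 1 - n = n + 1 by omega] at this
    calc _ ≤ 4 ^ n * (2 ^ n * B) := by gcongr
      _ = 8 ^ n * B := by rw [← mul_assoc, ← mul_pow]; norm_num
  have hD : ‖exponential hψ ((t + n * h) • v) - S‖ ≤
      (4 * (h * R)) ^ n + 16 ^ n * Real.exp (-ψ R) := by
    refine norm_le_of_forall _ fun x => ?_
    set w := expFun ((-h) • v) x with hw
    have hw1 : ‖w‖ = 1 := norm_expFun _ _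
    -- `S` is the half `k ≥ n` of the expansion: the factor `w ^ n` moves the frequency from `t + n
    -- h` back to `t`.
    have hval : toFunₗ d ψ (exponential hψ ((t + n * h) • v) - S) x =
        expFun ((t + n * h) • v) x * ∑ k ∈ Finset.range n,
          ((2 * n).choose k : ℂ) * (w ^ k * (1 - w) ^ (2 * n - k)) := by
      rw [← one_sub_pow_mul_sum_choose, map_sub, Pi.sub_apply, toFunₗ_exponential, mul_sub,
        mul_one, ← mul_assoc]
      congr 1
      have e1 : expFun ((t + n * h) • v) x * w ^ n = expFun (t • v) x := by
        rw [hw, ← expFun_natCast_mul_smul, ← expFun_add_smul]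
        ring_nf
      rw [e1, hS, map_sum, Finset.sum_apply, Finset.mul_sum]
      refine Finset.sum_congr rfl fun j _ => ?_
      rw [map_smul, Pi.smul_apply, toFunₗ_backwardDiff, sub_eq_add_neg, ← mul_neg,
        expFun_add_smul, expFun_natCast_mul_smul, smul_eq_mul]
      ring
    rw [hval, norm_mul, norm_expFun, one_mul]
    have hexp1 : 1 ≤ Real.exp (ψ ‖x‖₊) := Real.one_le_exp (ψ ‖x‖₊).2
    -- For `‖x‖ ≤ R`, each exponent `2 n - k` exceeds `n` and `‖1 - w‖ ≤ h R ≤ 1`. Beyond `R` only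
    -- `‖1 - w‖ ≤ 2` is available, and the weight pays for the resulting `16 ^ n`.
    rcases le_or_gt ‖x‖₊ R with hx | hx
    · have hu : ‖1 - w‖ ≤ h * R := by
        rw [norm_sub_rev, hw, expFun_smul]
        refine Real.norm_exp_I_mul_ofReal_sub_one_le.trans ?_
        rw [norm_mul, norm_neg, Real.norm_of_nonneg hh]
        gcongr
        calc _ ≤ ‖v‖ * ‖x‖ := norm_inner_le_norm v x
          _ ≤ 1 * R := by gcongr; exact_mod_cast hx
          _ = R := one_mul _
      have h1 := norm_sum_choose_le n hw1 (c := (h * R) ^ n) (by positivity) fun k hk =>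
        (pow_le_pow_left₀ (norm_nonneg _) hu _).trans
          (pow_le_pow_of_le_one (by positivity) hR (by omega))
      rw [← mul_pow] at h1
      refine h1.trans ?_
      calc (4 * (h * R)) ^ n ≤ (4 * (h * R)) ^ n + 16 ^ n * Real.exp (-ψ R) := by
            simp; positivity
        _ ≤ _ := le_mul_of_one_le_right (by positivity) hexp1
    · have hu : ‖1 - w‖ ≤ 2 := by
        refine (norm_sub_le _ _).trans ?_
        rw [hw1, norm_one]
        norm_num
      have h1 := norm_sum_choose_le n hw1 (c := 4 ^ n) (by positivity) fun k hk => by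
        calc ‖1 - w‖ ^ (2 * n - k) ≤ 2 ^ (2 * n - k) := by gcongr
          _ ≤ 2 ^ (2 * n) := by gcongr <;> [norm_num; omega]
          _ = 4 ^ n := by rw [pow_mul]; norm_num
      rw [← mul_pow] at h1
      norm_num1 at h1
      have hψx : (ψ R : ℝ) ≤ ψ ‖x‖₊ := by exact_mod_cast hψ_mono hx.le
      have h2 : 1 ≤ Real.exp (-ψ R) * Real.exp (ψ ‖x‖₊) := by
        rw [← Real.exp_add]
        exact Real.one_le_exp (by linarith)
      calc _ ≤ (16 : ℝ) ^ n := h1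
        _ ≤ 16 ^ n * (Real.exp (-ψ R) * Real.exp (ψ ‖x‖₊)) :=
            le_mul_of_one_le_right (by positivity) h2
        _ = 16 ^ n * Real.exp (-ψ R) * Real.exp (ψ ‖x‖₊) := by ring
        _ ≤ _ := by gcongr; simp; positivity
  calc _ = p ((exponential hψ ((t + n * h) • v) - S) + S) := by rw [sub_add_cancel]
    _ ≤ p (exponential hψ ((t + n * h) • v) - S) + p S := map_add_le_add p _ _
    _ ≤ _ := add_le_add ((hp _).trans hD) hpS

/-- Descent from the bound `64 ^ (-8m)` to the bound `64 ^ (-m)`, across a length `8m / (16 R)`. -/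
theorem seminorm_exponential_step (p : Seminorm ℂ (WeightedSpace d ψ))
    (hp : ∀ φ, p φ ≤ ‖φ‖) (hψ : Tendsto ψ atTop atTop) (hψ_mono : Monotone ψ)
    {v : EuclideanSpace ℝ (Fin d)} (hv : ‖v‖ ≤ 1) {m : ℕ} (hm : 0 < m) {R : ℝ≥0} (hR : 0 < R)
    (hψR : ((8 * m : ℕ) : ℝ) * 5 ≤ ψ R) {a b : ℝ} (ha : ((8 * m : ℕ) : ℝ) / (16 * R) * 2 ≤ a)
    (hb : 0 ≤ b)
    (hB : ∀ s, -a ≤ s → s ≤ b → p (exponential hψ (s • v)) ≤ (64⁻¹) ^ (8 * m)) :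
    ∀ s, -a ≤ s → s ≤ b + ((8 * m : ℕ) : ℝ) / (16 * R) →
      p (exponential hψ (s • v)) ≤ (64⁻¹) ^ m := by
  intro s hs hs'
  have hR' : (0 : ℝ) < R := hR
  rcases le_or_gt s b with hsb | hsb
  · exact (hB s hs hsb).trans (pow_le_pow_of_le_one (by norm_num) (by norm_num) (by omega))
  set n := 8 * m with hn
  have hstep : (n : ℝ) / (16 * R) = n * (1 / (16 * R)) := by ring
  have hhR : 1 / (16 * (R : ℝ)) * R = 1 / 16 := by field_simp
  -- The samples lie in `[s - 2 n h, s - n h]`, which is inside `[-a, b]` because `s > b ≥ 0` and `2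
  -- n h ≤ a`. Each of the three error terms is at most `4 ^ (-n)`.
  have key := seminorm_exponential_extrapolate p hp hψ hψ_mono hv n (h := 1 / (16 * R))
    (B := (64⁻¹) ^ n) (by positivity) R (by rw [hhR]; norm_num) (s - n * (1 / (16 * R)))
    (fun r hr hr' => hB r (by linarith) (by linarith))
  rw [sub_add_cancel, hhR] at key
  have hexp : Real.exp (-ψ R) ≤ (64⁻¹) ^ n := by
    have h5 : (64 : ℝ) ≤ Real.exp 5 := by
      calc (64 : ℝ) ≤ 2.7 ^ 5 := by norm_num
        _ ≤ Real.exp 1 ^ 5 := by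
            gcongr
            exact (by norm_num : (2.7 : ℝ) ≤ 2.7182818283).trans Real.exp_one_gt_d9.le
        _ = Real.exp 5 := by rw [← Real.exp_nat_mul]; norm_num
    rw [Real.exp_neg, inv_pow]
    gcongr
    calc (64 : ℝ) ^ n ≤ Real.exp 5 ^ n := by gcongr
      _ = Real.exp (n * 5) := by rw [← Real.exp_nat_mul]
      _ ≤ _ := Real.exp_le_exp.2 hψR
  calc _ ≤ _ := key
    _ ≤ (4 * (1 / 16)) ^ n + 16 ^ n * (64⁻¹) ^ n + 16 ^ n * (64⁻¹) ^ n := by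
        gcongr
        norm_num
    _ = 3 * ((4⁻¹) ^ 8) ^ m := by
        rw [← mul_pow, ← pow_mul, ← hn]
        norm_num
        ring
    -- The ratio 8 between levels leaves room here: `64 * 4 ^ (-8) = 4 ^ (-5) ≤ 64⁻¹`.
    _ ≤ 64 ^ m * ((4⁻¹) ^ 8) ^ m := by
        gcongr
        calc (3 : ℝ) ≤ 64 ^ 1 := by norm_num
          _ ≤ 64 ^ m := by gcongr <;> [norm_num; omega]
    _ = (64 * (4⁻¹) ^ 8) ^ m := by rw [← mul_pow]
    _ ≤ _ := by gcongr; norm_num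

end WeightedSpace

/-! ### Radii from the divergent integral -/

theorem lintegral_Ioi_div_sq {c K : ℝ} (hc : 0 < c) (hK : 0 ≤ K) :
    ∫⁻ r in Set.Ioi c, ENNReal.ofReal (K / r ^ 2) = ENNReal.ofReal (K / c) := by
  have hint : IntegrableOn (fun r : ℝ => K * r ^ (-2 : ℝ)) (Set.Ioi c) :=
    (integrableOn_Ioi_rpow_of_lt (by norm_num) hc).const_mul K
  have heq : ∀ r ∈ Set.Ioi c, K / r ^ 2 = K * r ^ (-2 : ℝ) := fun r hr => by
    rw [Real.rpow_neg (hc.trans hr).le, div_eq_mul_inv]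
    norm_num
  rw [setLIntegral_congr_fun measurableSet_Ioi fun r hr => by rw [heq r hr],
    ← ofReal_integral_eq_lintegral_ofReal hint
      (ae_restrict_of_forall_mem measurableSet_Ioi fun r hr => by
        have := (hc.trans hr).le
        simp only [Pi.zero_apply]
        positivity),
    integral_const_mul, integral_Ioi_rpow_of_lt (by norm_num) hc]
  congr 1
  norm_num
  rw [Real.rpow_neg_one]
  ring

/-- The integral condition produces radii `R k` with `ψ (R k) ≥ 5 * 8 ^ k` and
`∑ 8 ^ k / R k = ∞`. -/
theorem exists_radii_not_summable {ψ : ℝ≥0 → ℝ≥0} (hψ : Tendsto ψ atTop atTop)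
    (hψ_mono : Monotone ψ)
    (hψ_int : ∫⁻ r in Set.Ioi (1 : ℝ), ENNReal.ofReal ((ψ r.toNNReal : ℝ) / r ^ 2) = ⊤) :
    ∃ R : ℕ → ℝ≥0, (∀ k, 0 < R k) ∧ (∀ k, 8 ^ k * 5 ≤ ψ (R k)) ∧
      ¬ Summable fun k => (8 : ℝ) ^ k / R k := by
  have hne : ∀ k : ℕ, {r : ℝ≥0 | 8 ^ k * 5 ≤ ψ r}.Nonempty := fun k =>
    (hψ.eventually_ge_atTop (8 ^ k * 5)).exists
  set ρ : ℕ → ℝ≥0 := fun k => sInf {r : ℝ≥0 | 8 ^ k * 5 ≤ ψ r} with hρ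
  -- The infimum need not be attained; adding 1 passes it and also makes the radius positive.
  refine ⟨fun k => ρ k + 1, fun k => by positivity, fun k => ?_, fun hsum => ?_⟩
  · obtain ⟨r, hr, hr'⟩ := exists_lt_of_csInf_lt (hne k) (lt_add_one (ρ k))
    exact le_trans hr (hψ_mono hr'.le)
  have hle : ∀ k r, 8 ^ k * 5 ≤ ψ r → ρ k ≤ r := fun k r h => csInf_le' h
  set c : ℕ → ℝ := fun k => ((ρ k + 1 : ℝ≥0) : ℝ) / 2 with hc
  have hc0 : ∀ k, 0 < c k := fun k => by simp only [hc]; positivity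
  set G : ℕ → ℝ → ℝ≥0∞ := fun k => (Set.Ioi (c k)).indicator
    fun r => ENNReal.ofReal (40 * 8 ^ k / r ^ 2) with hG
  have hGm : ∀ k, Measurable (G k) := fun k =>
    Measurable.indicator (by fun_prop) measurableSet_Ioi
  -- Where `5 * 8 ^ k ≤ ψ < 5 * 8 ^ (k + 1) = 40 * 8 ^ k`, the term `G k` dominates: `r ≥ ρ k` and
  -- `r > 1` give `r > c k`.
  have hpt : ∀ r ∈ Set.Ioi (1 : ℝ), ENNReal.ofReal ((ψ r.toNNReal : ℝ) / r ^ 2) ≤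
      ENNReal.ofReal (5 / r ^ 2) + ∑' k, G k r := by
    intro r hr
    have hr1 : 1 < r := hr
    rcases lt_or_ge (ψ r.toNNReal) 5 with h5 | h5
    · refine le_trans (ENNReal.ofReal_le_ofReal ?_) le_self_add
      gcongr
      exact_mod_cast h5.le
    · obtain ⟨k, hk, hk'⟩ : ∃ k : ℕ, 8 ^ k * 5 ≤ ψ r.toNNReal ∧ ψ r.toNNReal < 8 ^ (k + 1) * 5 := by
        obtain ⟨k, hk, hk'⟩ := exists_nat_pow_near (x := ψ r.toNNReal / 5) (y := 8)
          ((one_le_div (by norm_num)).2 h5) (by norm_num)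
        exact ⟨k, (le_div_iff₀ (by norm_num)).1 hk, (div_lt_iff₀ (by norm_num)).1 hk'⟩
      refine le_trans (le_trans ?_ (ENNReal.le_tsum k)) le_add_self
      have hρr : (ρ k : ℝ) ≤ r := by
        have : (ρ k : ℝ) ≤ r.toNNReal := by exact_mod_cast hle k _ hk
        rwa [Real.coe_toNNReal _ (by linarith)] at this
      have hmem : r ∈ Set.Ioi (c k) := by
        simp only [hc, Set.mem_Ioi]
        push_cast
        linarith
      simp only [hG, Set.indicator_of_mem hmem]
      refine ENNReal.ofReal_le_ofReal ?_
      gcongr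
      have : (ψ r.toNNReal : ℝ) < 8 ^ (k + 1) * 5 := by exact_mod_cast hk'
      rw [pow_succ] at this
      linarith
  have hfin : ∫⁻ r in Set.Ioi (1 : ℝ), (ENNReal.ofReal (5 / r ^ 2) + ∑' k, G k r) ≠ ⊤ := by
    rw [lintegral_add_left (by fun_prop), lintegral_Ioi_div_sq one_pos (by norm_num),
      lintegral_tsum fun k => (hGm k).aemeasurable]
    refine ENNReal.add_ne_top.2 ⟨ENNReal.ofReal_ne_top, ?_⟩
    -- The integral of `G k` is `40 * 8 ^ k / c k`, that is, `80 * 8 ^ k / (ρ k + 1)`.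
    refine ne_top_of_le_ne_top (hsum.mul_left 80).tsum_ofReal_ne_top
      (ENNReal.tsum_le_tsum fun k =>
        (setLIntegral_le_lintegral (Set.Ioi 1) (G k)).trans_eq ?_)
    rw [lintegral_indicator measurableSet_Ioi, lintegral_Ioi_div_sq (hc0 k) (by positivity)]
    congr 1
    simp only [hc]
    field_simp
    norm_num
  exact hfin (top_le_iff.1 (hψ_int ▸ setLIntegral_mono' measurableSet_Ioi hpt))

/-- Wherever the maximum is `f k / a`, the new term equals `a`. If the new series converged, this
would happen only finitely often, so the two series would share a tail. The lemma caps step lengths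
without losing divergence. -/
theorem not_summable_div_max {f R : ℕ → ℝ} {a : ℝ} (hf : ∀ k, 0 < f k) (ha : 0 < a)
    (h : ¬ Summable fun k => f k / R k) : ¬ Summable fun k => f k / max (R k) (f k / a) := by
  intro hs
  refine h ((summable_congr_atTop ?_).1 hs)
  filter_upwards [hs.tendsto_atTop_zero.eventually (gt_mem_nhds ha)] with k hk
  rcases le_total (f k / a) (R k) with h1 | h1
  · rw [max_eq_left h1]
  · rw [max_eq_right h1, div_div_cancel₀ (hf k).ne'] at hk
    exact absurd hk (lt_irrefl a)

/-! ### Quasi-analytic continuation -/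

namespace WeightedSpace

variable {d : ℕ} {ψ : ℝ≥0 → ℝ≥0}

/-- Quasi-analytic continuation: a seminorm bounded by the weighted norm that vanishes on the
exponentials with frequencies in a segment vanishes on those with frequencies in the whole ray. -/
theorem seminorm_exponential_eq_zero (p : Seminorm ℂ (WeightedSpace d ψ))
    (hp : ∀ φ, p φ ≤ ‖φ‖) (hψ : Tendsto ψ atTop atTop) (hψ_mono : Monotone ψ)
    (hψ_int : ∫⁻ r in Set.Ioi (1 : ℝ), ENNReal.ofReal ((ψ r.toNNReal : ℝ) / r ^ 2) = ⊤)
    {v : EuclideanSpace ℝ (Fin d)} (hv : ‖v‖ ≤ 1) {a : ℝ} (ha : 0 < a)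
    (hzero : ∀ t, -a ≤ t → t ≤ 0 → p (exponential hψ (t • v)) = 0) {t : ℝ} (ht : 0 ≤ t) :
    p (exponential hψ (t • v)) = 0 := by
  obtain ⟨R, hR0, hRψ, hRsum⟩ := exists_radii_not_summable hψ hψ_mono hψ_int
  have hns := not_summable_div_max (f := fun k => (8 : ℝ) ^ k) (a := 8 * a)
    (fun k => by positivity) (by positivity) hRsum
  lift a to ℝ≥0 using ha.le
  -- Enlarging the radii keeps twice each step length at most `a`, so the samples never fall below
  -- `-a`.
  set S : ℕ → ℝ≥0 := fun k => max (R k) (8 ^ k / (8 * a)) with hS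
  have hSR : ∀ k, R k ≤ S k := fun k => le_max_left _ _
  set σ : ℕ → ℝ := fun k => 8 ^ (k + 1) / (16 * (S (k + 1) : ℝ)) with hσ
  have hσ0 : ∀ k, 0 ≤ σ k := fun k => by positivity
  have hσsum : ¬ Summable σ := by
    intro h
    refine hns ((summable_nat_add_iff 1).1 ((h.mul_left 16).congr fun k => ?_))
    have hSk : (S (k + 1) : ℝ) = max (R (k + 1) : ℝ) (8 ^ (k + 1) / (8 * a)) := by
      simp [hS]
    rw [← hSk]
    simp only [hσ]
    have : (S (k + 1) : ℝ) ≠ 0 := (NNReal.coe_pos.2 ((hR0 _).trans_le (hSR _))).ne'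
    field_simp
  -- Here `j` counts descents: the chain starts at level `k + j` on `[-a, 0]`, where `p` vanishes,
  -- and `σ i` is the length gained from level `i + 1` to level `i`.
  have main : ∀ (j k : ℕ) (s : ℝ), -(a : ℝ) ≤ s → s ≤ ∑ i ∈ Finset.range j, σ (k + i) →
      p (exponential hψ (s • v)) ≤ 64⁻¹ ^ (8 ^ k) := by
    intro j
    induction j with
    | zero =>
      intro k s hs hs'
      rw [hzero s hs (by simpa using hs')]
      positivity
    | succ j ih =>
      intro k s hs hs'
      have hcast : ((8 * 8 ^ k : ℕ) : ℝ) = 8 ^ (k + 1) := by push_cast; ring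
      refine seminorm_exponential_step p hp hψ hψ_mono hv (m := 8 ^ k) (by positivity)
        (R := S (k + 1)) ((hR0 _).trans_le (hSR _)) ?_ (a := a)
        (b := ∑ i ∈ Finset.range j, σ (k + 1 + i)) ?_ (Finset.sum_nonneg fun i _ => hσ0 _)
        (fun r hr hr' => (ih (k + 1) r hr hr').trans_eq (by rw [pow_succ' 8 k])) s hs ?_
      · rw [hcast]
        exact_mod_cast (hRψ (k + 1)).trans (hψ_mono (hSR (k + 1)))
      · rw [hcast]
        have h1 : (8 : ℝ) ^ (k + 1) / (8 * a) ≤ S (k + 1) := by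
          simp [hS]
        have h2 : (0 : ℝ) < S (k + 1) := (hR0 _).trans_le (hSR _)
        rw [div_le_iff₀ (by positivity)] at h1
        rw [div_mul_eq_mul_div, div_le_iff₀ (by positivity)]
        linarith
      · rw [hcast]
        rw [Finset.sum_range_succ'] at hs'
        simp only [add_zero] at hs'
        refine hs'.trans_eq ?_
        congr 1
        exact Finset.sum_congr rfl fun i _ => by rw [add_assoc, add_comm 1 i]
  refine le_antisymm (ge_of_tendsto' (x := atTop) (f := fun k : ℕ => (64⁻¹ : ℝ) ^ (8 ^ k))
    ?_ fun k => ?_) (apply_nonneg p _)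
  · exact (tendsto_pow_atTop_nhds_zero_of_lt_one (by norm_num) (by norm_num)).comp
      (tendsto_pow_atTop_atTop_of_one_lt (by norm_num))
  · have hk : ¬ Summable fun i => σ (k + i) := fun h =>
      hσsum ((summable_nat_add_iff k).1 (by simpa only [add_comm] using h))
    obtain ⟨j, hj⟩ := (((not_summable_iff_tendsto_nat_atTop_of_nonneg fun i => hσ0 _).1
      hk).eventually_ge_atTop t).exists
    exact main j k t (by linarith) hj

end WeightedSpace

/-! ### Density of trigonometric polynomials with arbitrary frequencies -/

/-- The trigonometric polynomials: the span of all the exponentials `e_l`. -/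
def trigSpan (d : ℕ) : Submodule ℂ (EuclideanSpace ℝ (Fin d) → ℂ) :=
  Submodule.span ℂ (Set.range expFun)

theorem expFun_mem_trigSpan {d : ℕ} (l : EuclideanSpace ℝ (Fin d)) : expFun l ∈ trigSpan d :=
  Submodule.subset_span ⟨l, rfl⟩

theorem expFun_zero {d : ℕ} : expFun (0 : EuclideanSpace ℝ (Fin d)) = 1 := by
  funext x
  simp [expFun]

theorem expFun_add {d : ℕ} (l m : EuclideanSpace ℝ (Fin d)) :
    expFun (l + m) = expFun l * expFun m := by
  funext x
  simp only [expFun, Pi.mul_apply, ← Complex.exp_add, inner_add_left]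
  congr 1
  push_cast
  ring

theorem star_expFun {d : ℕ} (l : EuclideanSpace ℝ (Fin d)) :
    star (expFun l) = expFun (-l) := by
  funext x
  simp only [expFun, Pi.star_apply, Complex.star_def, ← Complex.exp_conj, inner_neg_left]
  congr 1
  simp

theorem mul_mem_trigSpan {d : ℕ} {f g : EuclideanSpace ℝ (Fin d) → ℂ} (hf : f ∈ trigSpan d)
    (hg : g ∈ trigSpan d) : f * g ∈ trigSpan d := by
  have h := Submodule.mul_mem_mul hf hg
  rw [trigSpan, Submodule.span_mul_span] at h
  refine Submodule.span_mono ?_ h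
  rintro _ ⟨_, ⟨l, rfl⟩, _, ⟨m, rfl⟩, rfl⟩
  exact ⟨l + m, expFun_add l m⟩

theorem star_mem_trigSpan {d : ℕ} {f : EuclideanSpace ℝ (Fin d) → ℂ} (hf : f ∈ trigSpan d) :
    star f ∈ trigSpan d := by
  induction hf using Submodule.span_induction with
  | mem f hf =>
    obtain ⟨l, rfl⟩ := hf
    rw [star_expFun]
    exact expFun_mem_trigSpan _
  | zero => rw [star_zero]; exact zero_mem _
  | add f g _ _ hf hg => rw [star_add]; exact add_mem hf hg
  | smul c f _ hf => rw [star_smul]; exact Submodule.smul_mem _ _ hf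

/-- The map `x ↦ (sin (τ x_j) / τ)_j`, extended to `τ = 0` by the identity. -/
def sineMap {d : ℕ} (τ : ℝ) (x : EuclideanSpace ℝ (Fin d)) : EuclideanSpace ℝ (Fin d) :=
  WithLp.toLp 2 fun j => x j * Real.sinc (τ * x j)

theorem sineMap_zero {d : ℕ} (x : EuclideanSpace ℝ (Fin d)) : sineMap 0 x = x := by
  ext j
  simp [sineMap]

theorem continuous_sineMap {d : ℕ} :
    Continuous fun q : ℝ × EuclideanSpace ℝ (Fin d) => sineMap q.1 q.2 := by
  unfold sineMap
  have := Real.continuous_sinc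
  fun_prop

theorem sineMap_apply {d : ℕ} {τ : ℝ} (hτ : τ ≠ 0) (x : EuclideanSpace ℝ (Fin d)) (j : Fin d) :
    sineMap τ x j = Real.sin (τ * x j) / τ := by
  simp only [sineMap]
  rcases eq_or_ne (x j) 0 with h | h
  · simp [h]
  · rw [Real.sinc_of_ne_zero (mul_ne_zero hτ h)]
    field_simp

/-- The bound is uniform in `x`, so Stone–Weierstrass on one compact ball gives approximation on all
of `ℝ^d`. -/
theorem norm_sineMap_le {d : ℕ} {τ : ℝ} (hτ : 0 < τ) (x : EuclideanSpace ℝ (Fin d)) :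
    ‖sineMap τ x‖ ≤ √(d * (1 / τ) ^ 2) := by
  rw [EuclideanSpace.norm_eq]
  gcongr
  calc ∑ j, ‖sineMap τ x j‖ ^ 2 ≤ ∑ _j : Fin d, (1 / τ) ^ 2 := by
        refine Finset.sum_le_sum fun j _ => ?_
        gcongr
        rw [sineMap_apply hτ.ne', norm_div, Real.norm_of_nonneg hτ.le]
        gcongr
        exact Real.abs_sin_le_one _
    _ = d * (1 / τ) ^ 2 := by simp

theorem sineMap_coord_mem_trigSpan {d : ℕ} {τ : ℝ} (hτ : τ ≠ 0) (j : Fin d) :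
    (fun x : EuclideanSpace ℝ (Fin d) => ((sineMap τ x j : ℝ) : ℂ)) ∈ trigSpan d := by
  have h : (fun x : EuclideanSpace ℝ (Fin d) => ((sineMap τ x j : ℝ) : ℂ)) =
      (Complex.I / (2 * τ)) • (expFun (-EuclideanSpace.single j τ) -
        expFun (EuclideanSpace.single j τ)) := by
    funext x
    have hτ' : (τ : ℂ) ≠ 0 := by exact_mod_cast hτ
    have hin : inner ℝ (EuclideanSpace.single j τ) x = τ * x j := by
      rw [EuclideanSpace.inner_single_left]
      simp
    rw [sineMap_apply hτ]
    simp only [Pi.smul_apply, Pi.sub_apply, expFun, inner_neg_left, hin, smul_eq_mul]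
    push_cast
    rw [Complex.sin]
    field_simp
  rw [h]
  exact Submodule.smul_mem _ _ (sub_mem (expFun_mem_trigSpan _) (expFun_mem_trigSpan _))

/-- A continuous function of the sines `sin (τ x_j) / τ` is a uniform limit of trigonometric
polynomials. -/
theorem exists_trigSpan_near_comp_sineMap {d : ℕ} {f : EuclideanSpace ℝ (Fin d) → ℂ}
    (hf : Continuous f) {τ : ℝ} (hτ : 0 < τ) {ε : ℝ} (hε : 0 < ε) :
    ∃ g ∈ trigSpan d, ∀ x, ‖f (sineMap τ x) - g x‖ < ε := by
  set K : Set (EuclideanSpace ℝ (Fin d)) := Metric.closedBall 0 √(d * (1 / τ) ^ 2) with hK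
  have hmem : ∀ x, sineMap τ x ∈ K := fun x => mem_closedBall_zero_iff.2 (norm_sineMap_le hτ x)
  have : CompactSpace K := isCompact_iff_compactSpace.1 (isCompact_closedBall _ _)
  let coord : Fin d → C(K, ℂ) := fun j => ⟨fun y => ((y.1 j : ℝ) : ℂ), by fun_prop⟩
  let A : StarSubalgebra ℂ C(K, ℂ) := StarAlgebra.adjoin ℂ (Set.range coord)
  have hA : A.topologicalClosure = ⊤ := by
    refine ContinuousMap.starSubalgebra_topologicalClosure_eq_top_of_separatesPoints A ?_
    intro y z hyz
    obtain ⟨j, hj⟩ : ∃ j, y.1 j ≠ z.1 j := by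
      by_contra! h
      exact hyz (Subtype.ext (PiLp.ext h))
    refine ⟨_, ⟨coord j, StarAlgebra.subset_adjoin ℂ _ ⟨j, rfl⟩, rfl⟩, ?_⟩
    simpa [coord] using hj
  have hcomp : ∀ b ∈ A, (fun x => b ⟨sineMap τ x, hmem x⟩) ∈ trigSpan d := by
    intro b hb
    induction hb using StarAlgebra.adjoin_induction with
    | mem b hb =>
      obtain ⟨j, rfl⟩ := hb
      exact sineMap_coord_mem_trigSpan hτ.ne' j
    | algebraMap c =>
      have : (fun x => (algebraMap ℂ C(K, ℂ) c) ⟨sineMap τ x, hmem x⟩) =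
          c • expFun (0 : EuclideanSpace ℝ (Fin d)) := by
        funext x
        simp [expFun_zero]
      rw [this]
      exact Submodule.smul_mem _ _ (expFun_mem_trigSpan 0)
    | add b c _ _ hb hc => exact add_mem hb hc
    | mul b c _ _ hb hc => exact mul_mem_trigSpan hb hc
    | star b _ hb => exact star_mem_trigSpan hb
  let F : C(K, ℂ) := ⟨fun y => f y.1, by fun_prop⟩
  have hF : F ∈ closure (A : Set C(K, ℂ)) := by
    rw [← StarSubalgebra.topologicalClosure_coe, hA]
    trivial
  obtain ⟨b, hb, hFb⟩ := Metric.mem_closure_iff.1 hF ε hε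
  refine ⟨_, hcomp b hb, fun x => ?_⟩
  have := (ContinuousMap.dist_lt_iff hε).1 hFb ⟨sineMap τ x, hmem x⟩
  rwa [dist_eq_norm] at this

/-- Weighted approximation of bounded continuous functions by trigonometric polynomials. -/
theorem exists_trigSpan_near_of_bounded {d : ℕ} {ψ : ℝ≥0 → ℝ≥0} (hψ : Tendsto ψ atTop atTop)
    {f : EuclideanSpace ℝ (Fin d) → ℂ} (hf : Continuous f) {C : ℝ} (hC : ∀ x, ‖f x‖ ≤ C)
    {ε : ℝ} (hε : 0 < ε) :
    ∃ g ∈ trigSpan d, ∀ x, ‖f x - g x‖ ≤ 2 * ε * Real.exp (ψ ‖x‖₊) := by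
  -- Off a compact set the weight absorbs the trivial bound `2 C` on the difference.
  have hweight := (tendsto_weight (d := d) hψ).eventually_ge_atTop (2 * C / ε)
  rw [Metric.cobounded_eq_cocompact, Filter.hasBasis_cocompact.eventually_iff] at hweight
  obtain ⟨K, hK, hK'⟩ := hweight
  -- Joint continuity of `sineMap` at `τ = 0`, where it is the identity, gives uniformity on the
  -- compact set `K`.
  have hnear : ∀ᶠ τ in 𝓝 (0 : ℝ), ∀ x ∈ K, ‖f x - f (sineMap τ x)‖ < ε := by
    refine hK.eventually_forall_of_forall_eventually fun x _ => ?_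
    have hcont : Continuous fun q : ℝ × EuclideanSpace ℝ (Fin d) =>
        ‖f q.2 - f (sineMap q.1 q.2)‖ := by
      have := continuous_sineMap (d := d)
      fun_prop
    refine hcont.continuousAt.eventually_lt continuousAt_const ?_
    simpa [sineMap_zero] using hε
  obtain ⟨τ, hτ, hτ0⟩ := ((hnear.filter_mono nhdsWithin_le_nhds).and
    (self_mem_nhdsWithin : Set.Ioi (0 : ℝ) ∈ 𝓝[>] 0)).exists
  obtain ⟨g, hg, hfg⟩ := exists_trigSpan_near_comp_sineMap hf hτ0 hε
  refine ⟨g, hg, fun x => ?_⟩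
  have hexp : ε ≤ ε * Real.exp (ψ ‖x‖₊) :=
    le_mul_of_one_le_right hε.le (Real.one_le_exp (ψ ‖x‖₊).2)
  have h1 : ‖f x - f (sineMap τ x)‖ ≤ ε * Real.exp (ψ ‖x‖₊) := by
    by_cases hx : x ∈ K
    · exact (hτ x hx).le.trans hexp
    · have h2 := hK' hx
      rw [div_le_iff₀' hε] at h2
      refine (norm_sub_le _ _).trans (le_trans ?_ h2)
      linarith [hC x, hC (sineMap τ x)]
  calc ‖f x - g x‖ ≤ ‖f x - f (sineMap τ x)‖ + ‖f (sineMap τ x) - g x‖ :=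
        norm_sub_le_norm_sub_add_norm_sub _ _ _
    _ ≤ 2 * ε * Real.exp (ψ ‖x‖₊) := by linarith [hfg x]

/-- Weighted approximation of functions in `C_ψ(ℝ^d)` by bounded continuous functions. -/
theorem exists_bounded_near {d : ℕ} {ψ : ℝ≥0 → ℝ≥0} {f : EuclideanSpace ℝ (Fin d) → ℂ}
    (hf : f ∈ weightedSubmodule d ψ) {ε : ℝ} (hε : 0 < ε) :
    ∃ g : EuclideanSpace ℝ (Fin d) → ℂ, Continuous g ∧ (∃ C, ∀ x, ‖g x‖ ≤ C) ∧
      ∀ x, ‖f x - g x‖ ≤ ε * Real.exp (ψ ‖x‖₊) := by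
  obtain ⟨hfc, hft⟩ := hf
  obtain ⟨r, -, hr⟩ := (Metric.hasBasis_cobounded_compl_closedBall
    (0 : EuclideanSpace ℝ (Fin d))).eventually_iff.1
    ((tendsto_zero_iff_norm_tendsto_zero.1 hft).eventually (gt_mem_nhds hε))
  obtain ⟨C, hC⟩ := (isCompact_closedBall (0 : EuclideanSpace ℝ (Fin d))
    (r + 1)).exists_bound_of_continuousOn hfc.continuousOn
  set χ : EuclideanSpace ℝ (Fin d) → ℝ := fun x => max 0 (min 1 (r + 1 - ‖x‖)) with hχ
  have hχ0 : ∀ x, 0 ≤ χ x := fun x => le_max_left _ _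
  have hχ1 : ∀ x, χ x ≤ 1 := fun x => max_le zero_le_one (min_le_left _ _)
  refine ⟨fun x => χ x * f x, by fun_prop, ⟨max C 0, fun x => ?_⟩, fun x => ?_⟩
  · rw [norm_mul, Complex.norm_real, Real.norm_of_nonneg (hχ0 x)]
    rcases le_or_gt ‖x‖ (r + 1) with hx | hx
    · exact (mul_le_of_le_one_left (norm_nonneg _) (hχ1 x)).trans
        ((hC x (mem_closedBall_zero_iff.2 hx)).trans (le_max_left _ _))
    · have : χ x = 0 := max_eq_left ((min_le_right _ _).trans (by linarith))
      simp [this]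
  · have h1 : f x - χ x * f x = ((1 - χ x : ℝ) : ℂ) * f x := by push_cast; ring
    rw [h1, norm_mul, Complex.norm_real, Real.norm_of_nonneg (by linarith [hχ1 x])]
    rcases le_or_gt ‖x‖ r with hx | hx
    · have : χ x = 1 := by
        simp only [hχ]
        rw [min_eq_left (by linarith), max_eq_right zero_le_one]
      rw [this]
      simp only [sub_self, zero_mul]
      positivity
    · have h2 := hr (show x ∈ (Metric.closedBall 0 r)ᶜ by simpa using hx)
      rw [norm_div, Complex.norm_real, Real.norm_of_nonneg (Real.exp_pos _).le,
        div_lt_iff₀ (Real.exp_pos _)] at h2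
      exact (mul_le_of_le_one_left (norm_nonneg _) (by linarith [hχ0 x])).trans h2.le

/-! ### Density of the exponentials with frequencies in the cube -/

namespace WeightedSpace

variable {d : ℕ} {ψ : ℝ≥0 → ℝ≥0}

/-- The exponentials span a dense subspace of `C_ψ(ℝ^d)`. -/
theorem dense_span_range_exponential (hψ : Tendsto ψ atTop atTop) :
    Dense (Submodule.span ℂ (Set.range (exponential (d := d) hψ)) :
      Set (WeightedSpace d ψ)) := by
  intro φ
  refine Metric.mem_closure_iff.2 fun ε hε => ?_
  obtain ⟨f, hfc, ⟨C, hC⟩, hf⟩ := exists_bounded_near (f := toFunₗ d ψ φ) φ.2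
    (show 0 < ε / 4 by positivity)
  obtain ⟨g, hg, hfg⟩ := exists_trigSpan_near_of_bounded hψ hfc hC
    (show 0 < ε / 4 by positivity)
  have hmap : trigSpan d = (Submodule.span ℂ (Set.range (exponential hψ))).map (toFunₗ d ψ) := by
    rw [Submodule.map_span, ← Set.range_comp]
    rfl
  rw [hmap] at hg
  obtain ⟨G, hG, rfl⟩ := hg
  refine ⟨G, hG, ?_⟩
  rw [dist_eq_norm]
  refine (norm_le_of_forall _ (C := 3 * (ε / 4)) fun x => ?_).trans_lt (by linarith)
  rw [map_sub, Pi.sub_apply]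
  refine (norm_sub_le_norm_sub_add_norm_sub _ (f x) _).trans ?_
  linarith [hf x, hfg x]

theorem exponential_mem_closure (hd : 1 ≤ d) (hψ_mono : Monotone ψ) (hψ : Tendsto ψ atTop atTop)
    (hψ_int : ∫⁻ r in Set.Ioi (1 : ℝ), ENNReal.ofReal ((ψ r.toNNReal : ℝ) / r ^ 2) = ⊤)
    {L : ℝ} (hL : 0 < L) (l : EuclideanSpace ℝ (Fin d)) :
    exponential hψ l ∈
      closure (((expSpan d L).comap (toFunₗ d ψ) : Submodule ℂ (WeightedSpace d ψ)) :
        Set (WeightedSpace d ψ)) := by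
  set M : Submodule ℂ (WeightedSpace d ψ) := (expSpan d L).comap (toFunₗ d ψ) with hM
  -- The quotient norm is the distance to `M`, so it vanishes exactly on the closure and is bounded
  -- by the weighted norm.
  let p : Seminorm ℂ (WeightedSpace d ψ) := (normSeminorm ℂ (WeightedSpace d ψ ⧸ M)).comp M.mkQ
  have hp0 : ∀ φ, p φ = 0 ↔ φ ∈ closure (M : Set (WeightedSpace d ψ)) := fun φ =>
    QuotientAddGroup.norm_mk_eq_zero_iff_mem_closure (S := M.toAddSubgroup)
  have hd0 : (0 : ℝ) < √(d : ℝ) := Real.sqrt_pos.2 (by exact_mod_cast hd)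
  have ha : 0 < L / √(d : ℝ) := by positivity
  set v : EuclideanSpace ℝ (Fin d) := ‖l‖⁻¹ • l with hv
  have hv1 : ‖v‖ ≤ 1 := by
    rw [hv, norm_smul, norm_inv, norm_norm]
    exact inv_mul_le_one
  have hl : l = ‖l‖ • v := by
    rcases eq_or_ne l 0 with rfl | h
    · simp
    · rw [hv, smul_inv_smul₀ (norm_ne_zero_iff.2 h)]
  rw [← hp0, hl]
  -- Half of `L / √d` keeps the closed segment inside the open cube.
  refine seminorm_exponential_eq_zero p (fun φ => Submodule.Quotient.norm_mk_le M φ) hψ hψ_mono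
    hψ_int hv1 (half_pos ha) (fun t ht ht' => (hp0 _).2 (subset_closure ?_)) (norm_nonneg l)
  refine Submodule.subset_span ⟨t • v, fun j => ?_, rfl⟩
  calc |(t • v) j| ≤ ‖t • v‖ := PiLp.norm_apply_le (t • v) j
    _ ≤ |t| * 1 := by
        rw [norm_smul, Real.norm_eq_abs]
        gcongr
    _ < L / √(d : ℝ) := by
        rw [abs_of_nonpos ht']
        linarith

end WeightedSpace

theorem expSpan_le_weightedSubmodule {d : ℕ} {ψ : ℝ≥0 → ℝ≥0} (hψ : Tendsto ψ atTop atTop)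
    (L : ℝ) : expSpan d L ≤ weightedSubmodule d ψ := by
  refine Submodule.span_le.2 ?_
  rintro _ ⟨l, -, rfl⟩
  exact (WeightedSpace.exponential hψ l).2

end

/-- If `ψ : [0,∞) → [0,∞)` is increasing, tends to infinity and `∫₁^∞ ψ(r)/r² dr = ∞`, then
`Φ_L(ℝ^d)` is a dense linear subspace of `(C_ψ(ℝ^d), ‖·‖_ψ)` for every `L > 0`. -/
theorem lemma2p2 (d : ℕ) (hd : 1 ≤ d) (ψ : ℝ≥0 → ℝ≥0) (hψ_mono : Monotone ψ)
    (hψ_lim : Tendsto ψ atTop atTop)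
    (hψ_int : ∫⁻ r in Set.Ioi (1 : ℝ), ENNReal.ofReal ((ψ r.toNNReal : ℝ) / r ^ 2) = ⊤)
    (L : ℝ) (hL : 0 < L) :
    expSpan d L ≤ weightedSubmodule d ψ ∧
      Dense (((expSpan d L).comap (WeightedSpace.toFunₗ d ψ) :
        Submodule ℂ (WeightedSpace d ψ)) : Set (WeightedSpace d ψ)) := by
  refine ⟨expSpan_le_weightedSubmodule hψ_lim L, ?_⟩
  rw [← dense_closure, ← Submodule.topologicalClosure_coe]
  refine (WeightedSpace.dense_span_range_exponential hψ_lim).mono (Submodule.span_le.2 ?_)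
  rintro _ ⟨l, rfl⟩
  exact WeightedSpace.exponential_mem_closure hd hψ_mono hψ_lim hψ_int hL l
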